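/- Let $E$ be a real Banach space whose dual $E^*$ has the Radon–Nikodým property (every countably additive $E^*$-valued measure of bounded variation that is absolutely continuous with respect to a finite measure $\lambda$ has a Bochner $\lambda$-integrable density), and let $(\Omega,\mathcal F,\mu)$ be a finite measure space. Let $\mathcal L^1_E$ be the space of Bochner $\mu$-integrable functions $\Omega\to E$. Let $(f_k)$ be a sequence in $\mathcal L^1_E$ and $f_0\in\mathcal L^1_E$. Suppose that $(f_k)$ is uniformly integrable, i.e. $$\lim_{c\to\infty}\ \sup_k \int_{\{\|f_k\|\ge c\}}\|f_k\|\,d\mu=0,$$ and that $x^*(f_k)\to x^*(f_0)$ in $\mu$-measure for every $x^*\in E^*$. Then $(f_k)$ converges limitedly to $f_0$, i.e. $$\lim_{k\to\infty}\int_\Omega g\big(\omega,f_k(\omega)-f_0(\omega)\big)\,d\mu(\omega)=0$$ for every function $g:\Omega\times E\to\mathbb R$ such that 1. $g(\omega,0)=0$ for each $\omega\in\Omega$; 2. $g(\omega,\cdot)$ is continuous for the weak topology $\sigma(E,E^*)$ for each $\omega\in\Omega$; 3. there are $C>0$ and a $\mu$-integrable $\phi:\Omega\to\mathbb R$ with $|g(\omega,x)|\le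 C\|x\|+\phi(\omega)$ for all $\omega\in\Omega$, $x\in E$; 4. for each $f\in\mathcal L^1_E$ the function $\omega\mapsto g(\omega,f(\omega))$ is $\mu$-measurable, i.e. $\mu$-almost everywhere equal to an $\mathcal F$-measurable function. -/

import Mathlib

open MeasureTheory Filter Topology
open scoped ENNReal

/-- The Radon–Nikodým property of a real Banach space `X`: for every finite measure space
`(S, Σ, lam)`, every countably additive `X`-valued measure on `Σ` of bounded variation that is
absolutely continuous with respect to `lam` has a Bochner integrable density.
Here `S` ranges over `Type`; since the property is already decided by Lebesgue measure on
`[0, 1]`, measure spaces in other universes would not change it. -/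
def HasRadonNikodymProperty (X : Type*) [NormedAddCommGroup X] [NormedSpace ℝ X] : Prop :=
  ∀ (S : Type) [MeasurableSpace S] (lam : Measure S) [IsFiniteMeasure lam]
    (ν : VectorMeasure S X),
    ν.variation Set.univ < ∞ →
    (∀ A : Set S, MeasurableSet A → lam A = 0 → ν A = 0) →
    ∃ h : S → X, Integrable h lam ∧ ∀ A : Set S, MeasurableSet A → ν A = ∫ s in A, h s ∂lam

section

variable {Ω : Type*} [MeasurableSpace Ω] {E : Type*} [NormedAddCommGroup E]

/-- `lim_{c → ∞} sup_k ∫_{[‖f_k‖ ≥ c]} ‖f_k‖ dμ = 0`, with values in `[0, ∞]`. -/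
def IsUniformlyIntegrableSeq (μ : Measure Ω) (f : ℕ → Ω → E) : Prop :=
  Tendsto (fun c : ℝ => ⨆ k, ∫⁻ ω in {ω | c ≤ ‖f k ω‖}, ‖f k ω‖ₑ ∂μ) atTop (𝓝 0)

variable [NormedSpace ℝ E]

/-- `x*(f_k) → x*(f₀)` in measure, for each `x* ∈ E*`. -/
def TendstoScalarlyInMeasure (μ : Measure Ω) (f : ℕ → Ω → E) (f₀ : Ω → E) : Prop :=
  ∀ x : StrongDual ℝ E,
    TendstoInMeasure μ (fun k ω => x (f k ω)) atTop (fun ω => x (f₀ ω))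

/-- The class of test functions `g : Ω × E → ℝ` for limited convergence. Integrable functions are
taken up to null sets here (`Integrable` asks for almost everywhere strong measurability), so
measurability of `ω ↦ g(ω, f(ω))` is accordingly measurability with respect to the
`μ`-completion of the σ-algebra. -/
structure IsLimitedTestFunction (μ : Measure Ω) (g : Ω → E → ℝ) : Prop where
  map_zero : ∀ ω, g ω 0 = 0
  weakly_continuous : ∀ ω, Continuous fun x : WeakSpace ℝ E => g ω ((toWeakSpace ℝ E).symm x)
  growth : ∃ C : ℝ, 0 < C ∧ ∃ φ : Ω → ℝ, Integrable φ μ ∧ ∀ ω x, |g ω x| ≤ C * ‖x‖ + φ ω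
  measurable_comp : ∀ f : Ω → E, Integrable f μ → AEMeasurable (fun ω => g ω (f ω)) μ

/-- The integrals that define limited convergence exist. -/
theorem IsLimitedTestFunction.integrable_comp {μ : Measure Ω} {g : Ω → E → ℝ}
    (hg : IsLimitedTestFunction μ g) {f : Ω → E} (hf : Integrable f μ) :
    Integrable (fun ω => g ω (f ω)) μ := by
  obtain ⟨C, _, φ, hφ, h⟩ := hg.growth
  refine ((hf.norm.const_mul C).add hφ).mono' (hg.measurable_comp f hf).aestronglyMeasurable ?_
  exact Eventually.of_forall fun ω => h ω (f ω)

/-- `(f_k)` converges limitedly to `f₀`: `∫ g(ω, f_k(ω) - f₀(ω)) dμ(ω) → 0` for every test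
function `g`. -/
def TendstoLimitedly (μ : Measure Ω) (f : ℕ → Ω → E) (f₀ : Ω → E) : Prop :=
  ∀ g : Ω → E → ℝ, IsLimitedTestFunction μ g →
    Tendsto (fun k => ∫ ω, g ω (f k ω - f₀ ω) ∂μ) atTop (𝓝 0)

end

/-! The differences `f k - f₀` lie almost everywhere in one separable set. By Stegall's theorem, the
Radon–Nikodým property of the dual yields countably many functionals that approximate every
functional on that set, with error at most `ε * ‖v‖`. Every subsequence then has a further one along
which these countably many functionals of `f k - f₀` tend to 0 almost everywhere. Truncated where
the majorant `C₀ * ‖f k - f₀‖ + φ` of `g` is large, the differences are bounded, so they converge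
weakly to 0 pointwise, and dominated convergence applies to `g`. Uniform integrability makes the
discarded part small.

Stegall's theorem is proved by contradiction (`countable_of_pairwise_separated`). A bounded
uncountable separated set of functionals splits again and again into uncountable halves a gap `ε`
apart, which gives a dyadic tree. Points chosen in its nodes form a bounded sequence of functions on
the Cantor space, and the Radon–Nikodým property provides an integrable weak* limit `k`. The gaps
persist in the limit: `k` moves by at least `ε` in mean under every coordinate flip. But flips
preserve the measure and tend to the identity, so for integrable `k` this mean tends to 0. -/

/-! ### Weak* limits from the Radon–Nikodým property -/

/-- A finitely additive set function that is dominated by a finite measure has a density, if its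
range space has the Radon–Nikodým property. -/
theorem HasRadonNikodymProperty.exists_density {X : Type*} [NormedAddCommGroup X] [NormedSpace ℝ X]
    (hX : HasRadonNikodymProperty X) {S : Type} [MeasurableSpace S] (lam : Measure S)
    [IsFiniteMeasure lam] {L : Set S → X} {M : ℝ} (hM : 0 ≤ M)
    (hbound : ∀ A, MeasurableSet A → ‖L A‖ ≤ M * lam.real A)
    (hunion : ∀ A B, MeasurableSet A → MeasurableSet B → Disjoint A B → L (A ∪ B) = L A + L B) :
    ∃ k : S → X, Integrable k lam ∧ ∀ A, MeasurableSet A → L A = ∫ s in A, k s ∂lam := by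
  classical
  have hempty : L ∅ = 0 := by
    have := hbound ∅ .empty
    simpa using this
  have hfin : ∀ (f : ℕ → Set S), (∀ i, MeasurableSet (f i)) → Pairwise (Function.onFun Disjoint f) →
      ∀ F : Finset ℕ, L (⋃ i ∈ F, f i) = ∑ i ∈ F, L (f i) := by
    intro f hf hd F
    induction F using Finset.induction_on with
    | empty => simp [hempty]
    | insert a F ha ih =>
      rw [Finset.sum_insert ha, ← ih, Finset.set_biUnion_insert]
      refine hunion _ _ (hf a) (F.measurableSet_biUnion fun i _ => hf i) ?_
      rw [Set.disjoint_iUnion₂_right]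
      intro i hi
      exact hd fun e => ha (e ▸ hi)
  -- Countable additivity comes from domination: the remainder after finitely many sets has norm at
  -- most `M` times its measure.
  let ν : VectorMeasure S X := ⟨fun A => if MeasurableSet A then L A else 0, by simp [hempty],
    fun A hA => if_neg hA, by
    intro f hf hd
    simp only [hf, if_true, MeasurableSet.iUnion hf]
    rw [HasSum, tendsto_iff_norm_sub_tendsto_zero]
    have hs : HasSum (fun i => lam.real (f i)) (lam.real (⋃ i, f i)) := by
      rw [measureReal_def, measure_iUnion hd hf,
        ENNReal.tsum_toReal_eq fun i => measure_ne_top _ _]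
      refine (ENNReal.summable_toReal ?_).hasSum
      rw [← measure_iUnion hd hf]
      exact measure_ne_top _ _
    have ht : Tendsto (fun F : Finset ℕ => M * (lam.real (⋃ i, f i) - ∑ i ∈ F, lam.real (f i)))
        atTop (𝓝 0) := by
      have := (Tendsto.const_sub (lam.real (⋃ i, f i)) hs).const_mul M
      simpa using this
    refine squeeze_zero (fun _ => norm_nonneg _) (fun F => ?_) ht
    have hmF : MeasurableSet (⋃ i ∈ F, f i) := F.measurableSet_biUnion fun i _ => hf i
    have hsub : (⋃ i ∈ F, f i) ⊆ ⋃ i, f i := Set.iUnion₂_subset fun i _ => Set.subset_iUnion f i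
    have hmD := (MeasurableSet.iUnion hf).diff hmF
    have h1 := hunion ((⋃ i, f i) \ ⋃ i ∈ F, f i) (⋃ i ∈ F, f i) hmD hmF Set.disjoint_sdiff_left
    rw [Set.sdiff_union_of_subset hsub] at h1
    rw [h1, ← hfin f hf hd F, norm_sub_rev, add_sub_cancel_right]
    refine (hbound _ hmD).trans_eq ?_
    rw [measureReal_sdiff hsub hmF, measureReal_biUnion_finset (fun i _ j _ hij => hd hij)
      (fun i _ => hf i)]⟩
  have hν : ∀ A, MeasurableSet A → ν A = L A := fun A hA => if_pos hA
  have hvar : ν.variation ≤ ENNReal.ofReal M • lam := by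
    refine VectorMeasure.variation_le_of_forall_enorm_le fun A hA => ?_
    rw [← ofReal_norm, hν A hA]
    refine (ENNReal.ofReal_le_ofReal (hbound A hA)).trans_eq ?_
    rw [ENNReal.ofReal_mul hM, ofReal_measureReal]
    rfl
  obtain ⟨k, hk, hνk⟩ := hX S lam ν
    ((hvar Set.univ).trans_lt (ENNReal.mul_lt_top ENNReal.ofReal_lt_top (measure_lt_top _ _)))
    fun A hA h0 => by
      have := hbound A hA
      rw [measureReal_def, h0] at this
      rw [hν A hA]
      simpa using this
  exact ⟨k, hk, fun A hA => (hν A hA).symm.trans (hνk A hA)⟩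

/-- A bounded sequence of functions with values in a dual space with the Radon–Nikodým property
has a limit along every ultrafilter, in the sense of weak* convergence of the integrals over all
measurable sets. -/
theorem HasRadonNikodymProperty.exists_tendsto_setIntegral {E : Type*} [NormedAddCommGroup E]
    [NormedSpace ℝ E] (hE : HasRadonNikodymProperty (StrongDual ℝ E)) {S : Type}
    [MeasurableSpace S] (lam : Measure S) [IsFiniteMeasure lam]
    {ι : Type*} (U : Ultrafilter ι) {h : ι → S → StrongDual ℝ E} {M : ℝ} (hM0 : 0 ≤ M)
    (hM : ∀ m s, ‖h m s‖ ≤ M) (hint : ∀ m, Integrable (h m) lam) :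
    ∃ k : S → StrongDual ℝ E, Integrable k lam ∧ ∀ A, MeasurableSet A → ∀ v : E,
      Tendsto (fun m => ∫ s in A, h m s v ∂lam) U (𝓝 (∫ s in A, k s v ∂lam)) := by
  -- Banach–Alaoglu for each `A` separately; the ultrafilter makes all these limits exist at once,
  -- so additivity passes to them.
  have key : ∀ A : Set S, ∃ L : StrongDual ℝ E, ‖L‖ ≤ M * lam.real A ∧
      ∀ v : E, Tendsto (fun m => ∫ s in A, h m s v ∂lam) U (𝓝 (L v)) := by
    intro A
    have hc := WeakDual.isCompact_closedBall (𝕜 := ℝ) (E := E) 0 (M * lam.real A)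
    let F : ι → WeakDual ℝ E := fun m => StrongDual.toWeakDual (∫ s in A, h m s ∂lam)
    have hF : ∀ m, F m ∈ WeakDual.toStrongDual ⁻¹' Metric.closedBall 0 (M * lam.real A) := by
      intro m
      simp only [Set.mem_preimage, mem_closedBall_zero_iff]
      exact norm_setIntegral_le_of_norm_le_const (measure_lt_top _ _) (fun s _ => hM m s)
    obtain ⟨L, hL, hle⟩ := hc.ultrafilter_le_nhds' (U.map F)
      (Filter.Eventually.of_forall (f := (U : Filter ι)) hF)
    refine ⟨WeakDual.toStrongDual L, by simpa using hL, fun v => ?_⟩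
    have h1 : Tendsto F U (𝓝 L) := hle
    have h2 := ((WeakDual.eval_continuous (𝕜 := ℝ) v).tendsto L).comp h1
    refine h2.congr fun m => ?_
    exact ContinuousLinearMap.integral_apply (hint m).integrableOn v
  choose L hLn hLt using key
  obtain ⟨k, hk, hLk⟩ := hE.exists_density lam hM0 (fun A _ => hLn A) (L := L) (by
    intro A B _ hB hAB
    ext v
    refine tendsto_nhds_unique (hLt _ v) (((hLt A v).add (hLt B v)).congr fun m => ?_)
    have hi : Integrable (fun s => h m s v) lam := (hint m).apply_continuousLinearMap v
    exact (setIntegral_union hAB hB hi.integrableOn hi.integrableOn).symm)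
  refine ⟨k, hk, fun A hA v => ?_⟩
  have := hLt A v
  rwa [hLk A hA, ContinuousLinearMap.integral_apply hk.integrableOn] at this

/-! ### Coordinate flips on the Cantor space -/

/-- The fair coin tossing measure on the Cantor space. -/
noncomputable def coinMeasure : Measure (ℕ → Bool) :=
  Measure.infinitePi fun _ => (PMF.uniformOfFintype Bool).toMeasure

instance : IsProbabilityMeasure coinMeasure := by
  unfold coinMeasure; infer_instance

/-- Change the `n`-th coordinate of a point of the Cantor space. -/
def flipBit (n : ℕ) (s : ℕ → Bool) : ℕ → Bool := fun i => if i = n then !s i else s i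

theorem measurePreserving_not_uniform :
    MeasurePreserving Bool.not (PMF.uniformOfFintype Bool).toMeasure
      (PMF.uniformOfFintype Bool).toMeasure := by
  refine ⟨measurable_of_finite _, ?_⟩
  rw [PMF.toMeasure_map Bool.not _ (measurable_of_finite _)]
  congr 1
  ext b
  cases b <;> simp [PMF.map_apply]

theorem measurePreserving_flipBit (n : ℕ) :
    MeasurePreserving (flipBit n) coinMeasure coinMeasure := by
  have hm : Measurable (flipBit n) := by
    refine measurable_pi_lambda _ fun i => ?_
    unfold flipBit
    split_ifs
    · exact (measurable_of_finite Bool.not).comp (measurable_pi_apply i)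
    · exact measurable_pi_apply i
  refine ⟨hm, ?_⟩
  have := Measure.infinitePi_map_pi (μ := fun _ : ℕ => (PMF.uniformOfFintype Bool).toMeasure)
    (f := fun i b => if i = n then !b else b) (fun i => measurable_of_finite _)
  unfold coinMeasure
  refine Eq.trans this ?_
  congr 1
  funext i
  by_cases hi : i = n
  · simpa [hi] using measurePreserving_not_uniform.map_eq
  · simp [hi]

theorem tendsto_flipBit (s : ℕ → Bool) : Tendsto (fun n => flipBit n s) atTop (𝓝 s) := by
  rw [tendsto_pi_nhds]
  intro i
  refine tendsto_const_nhds.congr' ?_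
  filter_upwards [eventually_gt_atTop i] with n hn
  simp [flipBit, hn.ne]

/-- The analogue of continuity of translations in `L¹`: clear for bounded continuous functions since
flips tend pointwise to the identity, and general by density since flips preserve the measure. -/
theorem tendsto_integral_norm_sub_flipBit {X : Type*} [NormedAddCommGroup X] [NormedSpace ℝ X]
    {k : (ℕ → Bool) → X} (hk : Integrable k coinMeasure) :
    Tendsto (fun n => ∫ s, ‖k s - k (flipBit n s)‖ ∂coinMeasure) atTop (𝓝 0) := by
  rw [Metric.tendsto_atTop]
  intro ε hε
  obtain ⟨ψ, hψ, hψi⟩ := hk.exists_boundedContinuous_integral_sub_le (ε := ε / 4) (by positivity)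
  have h1 : Tendsto (fun n => ∫ s, ‖ψ s - ψ (flipBit n s)‖ ∂coinMeasure) atTop (𝓝 0) := by
    have : (0 : ℝ) = ∫ s, (0 : ℝ) ∂coinMeasure := by simp
    rw [this]
    refine tendsto_integral_of_dominated_convergence (fun _ => 2 * ‖ψ‖) (fun n => ?_)
      (integrable_const _) (fun n => ?_) ?_
    · exact (hψi.sub ((measurePreserving_flipBit n).integrable_comp_of_integrable hψi)).1.norm
    · refine Eventually.of_forall fun s => ?_
      rw [norm_norm]
      have a := ψ.norm_coe_le_norm s
      have b := ψ.norm_coe_le_norm (flipBit n s)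
      linarith [norm_sub_le (ψ s) (ψ (flipBit n s))]
    · refine Eventually.of_forall fun s => ?_
      have := ((ψ.continuous.tendsto s).comp (tendsto_flipBit s)).const_sub (ψ s)
      simpa using this.norm
  obtain ⟨N, hN⟩ := (Metric.tendsto_atTop.1 h1) (ε / 4) (by positivity)
  refine ⟨N, fun n hn => ?_⟩
  have hN := hN n hn
  have mp := measurePreserving_flipBit n
  have i1 : Integrable (fun s => ‖k s - ψ s‖) coinMeasure := (hk.sub hψi).norm
  have i2 : Integrable (fun s => ‖k (flipBit n s) - ψ (flipBit n s)‖) coinMeasure :=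
    mp.integrable_comp_of_integrable i1
  have i3 : Integrable (fun s => ‖ψ s - ψ (flipBit n s)‖) coinMeasure :=
    (hψi.sub (mp.integrable_comp_of_integrable hψi)).norm
  have e2 : ∫ s, ‖k (flipBit n s) - ψ (flipBit n s)‖ ∂coinMeasure
      = ∫ s, ‖k s - ψ s‖ ∂coinMeasure := by
    have := integral_map mp.aemeasurable (f := fun s => ‖k s - ψ s‖)
      (by rw [mp.map_eq]; exact i1.1)
    rw [mp.map_eq] at this
    exact this.symm
  have h2 : ∫ s, ‖k s - k (flipBit n s)‖ ∂coinMeasure ≤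
      ∫ s, (‖k s - ψ s‖ + ‖k (flipBit n s) - ψ (flipBit n s)‖ + ‖ψ s - ψ (flipBit n s)‖)
        ∂coinMeasure := by
    refine integral_mono (hk.sub (mp.integrable_comp_of_integrable hk)).norm
      ((i1.add i2).add i3) fun s => ?_
    have : k s - k (flipBit n s) = (k s - ψ s) - (k (flipBit n s) - ψ (flipBit n s))
      + (ψ s - ψ (flipBit n s)) := by abel
    change ‖k s - k (flipBit n s)‖ ≤ _
    rw [this]
    exact (norm_add_le _ _).trans (add_le_add_left (norm_sub_le _ _) _)
  rw [integral_add (f := fun s => ‖k s - ψ s‖ + ‖k (flipBit n s) - ψ (flipBit n s)‖)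
    (i1.add i2) i3, integral_add i1 i2, e2] at h2
  rw [Real.dist_0_eq_abs] at hN ⊢
  rw [abs_of_nonneg (integral_nonneg fun _ => norm_nonneg _)] at hN ⊢
  linarith

/-! ### Separated sets, dyadic trees and Stegall's theorem -/

/-- Any set either has a countable `r`-net or contains an uncountable set of points pairwise
related by `r`. -/
theorem exists_countable_net_or_uncountable_pairwise {α : Type*} (r : α → α → Prop)
    (hr : ∀ a b, r a b → r b a) :
    (∃ C : Set α, C.Countable ∧ ∀ a, ∃ c ∈ C, a = c ∨ ¬ r a c) ∨
      ∃ D : Set α, ¬ D.Countable ∧ D.Pairwise r := by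
  obtain ⟨D, hD⟩ := zorn_subset {D : Set α | D.Pairwise r} fun c hc hchain =>
    ⟨⋃₀ c, (Set.pairwise_sUnion hchain.directedOn).2 fun s hs => hc hs,
      fun s hs => Set.subset_sUnion_of_mem hs⟩
  by_cases hcount : D.Countable
  · refine Or.inl ⟨D, hcount, fun a => ?_⟩
    by_contra! hcon
    have hins : insert a D ∈ {D : Set α | D.Pairwise r} :=
      hD.prop.insert fun b hb _ => ⟨(hcon b hb).2, hr _ _ (hcon b hb).2⟩
    have ha : a ∈ D := hD.le_of_ge hins (Set.subset_insert a D) (Set.mem_insert a D)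
    exact (hcon a ha).1 rfl
  · exact Or.inr ⟨D, hcount, hD.prop⟩

/-- An uncountable set of functionals whose points are pairwise `ε`-separated by a countable family
of vectors has two uncountable subsets that are `ε`-separated by one vector of the family. -/
theorem exists_uncountable_split {E : Type*} [NormedAddCommGroup E] [NormedSpace ℝ E]
    {x : ℕ → E} {ε : ℝ} {U : Set (StrongDual ℝ E)} (hU : ¬ U.Countable)
    (hsep : U.Pairwise fun y z => ∃ j, ε < |(y - z) (x j)|) :
    ∃ (V : Bool → Set (StrongDual ℝ E)) (j : ℕ) (a : ℝ), (∀ b, V b ⊆ U) ∧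
      (∀ b, ¬ (V b).Countable) ∧ (∀ y ∈ V true, a + ε < y (x j)) ∧ ∀ y ∈ V false, y (x j) < a := by
  by_contra! hcon
  have h1 : ∀ (j : ℕ) (a : ℚ), {y ∈ U | (a : ℝ) + ε < y (x j)}.Countable ∨
      {y ∈ U | y (x j) < a}.Countable := by
    intro j a
    by_contra! h
    obtain ⟨y, hy, hya⟩ := hcon
      (fun b => if b then {y ∈ U | (a : ℝ) + ε < y (x j)} else {y ∈ U | y (x j) < a}) j a
      (fun b => by cases b <;> exact fun y hy => hy.1)
      (fun b => by cases b <;> simp only [Bool.false_eq_true, if_true, if_false] <;> tauto)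
      (fun y hy => hy.2)
    exact absurd hy.2 (not_lt.2 hya)
  -- For each direction and rational threshold, discard whichever sides are countable. Only
  -- countably many points go, so two remain; a threshold inside the gap between them would have
  -- discarded one.
  let N : ℕ → ℚ → Set (StrongDual ℝ E) := fun j a =>
    {z | ({y ∈ U | (a : ℝ) + ε < y (x j)}.Countable ∧ z ∈ {y ∈ U | (a : ℝ) + ε < y (x j)}) ∨
      ({y ∈ U | y (x j) < a}.Countable ∧ z ∈ {y ∈ U | y (x j) < a})}
  have hN : ∀ j a, (N j a).Countable := by
    intro j a
    refine Set.Countable.union (s := {z | _ ∧ _}) (t := {z | _ ∧ _}) ?_ ?_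
    · by_cases h : {y ∈ U | (a : ℝ) + ε < y (x j)}.Countable
      · exact h.mono fun z hz => hz.2
      · convert Set.countable_empty
        ext z; simp only [Set.mem_ofPred_eq, Set.mem_empty_iff_false, iff_false]; tauto
    · by_cases h : {y ∈ U | y (x j) < a}.Countable
      · exact h.mono fun z hz => hz.2
      · convert Set.countable_empty
        ext z; simp only [Set.mem_ofPred_eq, Set.mem_empty_iff_false, iff_false]; tauto
  have hNU : (⋃ j, ⋃ a, N j a).Countable :=
    Set.countable_iUnion fun j => Set.countable_iUnion fun a => hN j a
  have hrest : ¬ (U \ ⋃ j, ⋃ a, N j a).Countable := fun h =>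
    hU ((h.union hNU).mono fun y hy => by
      by_cases hy' : y ∈ ⋃ j, ⋃ a, N j a
      · exact Or.inr hy'
      · exact Or.inl ⟨hy, hy'⟩)
  have hnt : (U \ ⋃ j, ⋃ a, N j a).Nontrivial := by
    by_contra h
    exact hrest (Set.not_nontrivial_iff.1 h).finite.countable
  obtain ⟨y, hy, z, hz, hyz⟩ := hnt
  have main : ∀ y ∈ U \ ⋃ j, ⋃ a, N j a, ∀ z ∈ U \ ⋃ j, ⋃ a, N j a, ∀ j,
      ¬ ε < y (x j) - z (x j) := by
    intro y hy z hz j hlt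
    obtain ⟨a, ha1, ha2⟩ := exists_rat_btwn (show z (x j) < y (x j) - ε by linarith)
    rcases h1 j a with h | h
    · exact hy.2 (Set.mem_iUnion₂.2 ⟨j, a, Or.inl ⟨h, hy.1, by linarith⟩⟩)
    · exact hz.2 (Set.mem_iUnion₂.2 ⟨j, a, Or.inr ⟨h, hz.1, ha1⟩⟩)
  obtain ⟨j, hj⟩ := hsep hy.1 hz.1 hyz
  rcases lt_abs.1 hj with h | h
  · exact main y hy z hz j (by simpa using h)
  · exact main z hz y hy j (by simpa using h)

/-- A function on the Cantor space obtained by walking down a binary tree. -/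
def branchNode {α : Type*} (root : α) (child : α → Bool → α) (s : ℕ → Bool) : ℕ → α
  | 0 => root
  | n + 1 => child (branchNode root child s n) (s n)

theorem isLocallyConstant_branchNode {α : Type*} (root : α) (child : α → Bool → α) (n : ℕ) :
    IsLocallyConstant fun s => branchNode root child s n := by
  induction n with
  | zero => exact IsLocallyConstant.const root
  | succ n ih =>
    have hb : IsLocallyConstant fun s : ℕ → Bool => s n :=
      (IsLocallyConstant.iff_continuous _).2 (continuous_apply n)
    exact (ih.prodMk hb).comp fun p => child p.1 p.2

/-- Hence flipping bit `n` keeps the node at level `n` and exchanges its two children at level `n +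
1`. -/
theorem branchNode_congr {α : Type*} (root : α) (child : α → Bool → α) {s t : ℕ → Bool} (n : ℕ)
    (hst : ∀ i < n, s i = t i) : branchNode root child s n = branchNode root child t n := by
  induction n with
  | zero => rfl
  | succ n ih =>
    simp only [branchNode]
    rw [ih fun i hi => hst i (by omega), hst n (by omega)]

theorem branchNode_antitone {α : Type*} (root : α) (child : α → Bool → α) {β : Type*}
    (c : α → Set β) (hc : ∀ u b, c (child u b) ⊆ c u) (s : ℕ → Bool) :
    Antitone fun n => c (branchNode root child s n) :=
  antitone_nat_of_succ_le fun _ => hc _ _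

theorem IsLocallyConstant.integrable_coinMeasure {X : Type*} [NormedAddCommGroup X]
    {φ : (ℕ → Bool) → X} (hφ : IsLocallyConstant φ) : Integrable φ coinMeasure := by
  have hc := hφ.continuous
  exact hc.integrable_of_hasCompactSupport (HasCompactSupport.of_compactSpace φ)

/-- Convergence of integrals over sets passes to integrals against locally constant functions. -/
theorem tendsto_integral_apply_of_isLocallyConstant {E : Type*} [NormedAddCommGroup E]
    [NormedSpace ℝ E] {ι : Type*} {l : Filter ι} {h : ι → (ℕ → Bool) → StrongDual ℝ E}
    {k : (ℕ → Bool) → StrongDual ℝ E} (hh : ∀ m, Integrable (h m) coinMeasure)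
    (hk : Integrable k coinMeasure)
    (hlim : ∀ A, MeasurableSet A → ∀ v : E, Tendsto (fun m => ∫ s in A, h m s v ∂coinMeasure) l
      (𝓝 (∫ s in A, k s v ∂coinMeasure)))
    {φ : (ℕ → Bool) → E} (hφ : IsLocallyConstant φ) :
    Tendsto (fun m => ∫ s, h m s (φ s) ∂coinMeasure) l (𝓝 (∫ s, k s (φ s) ∂coinMeasure)) := by
  classical
  -- Compactness of the Cantor space reduces the integral to a finite sum over fibres.
  have hfin : (Set.range φ).Finite := hφ.range_finite
  have expand : ∀ q : (ℕ → Bool) → StrongDual ℝ E, Integrable q coinMeasure →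
      ∫ s, q s (φ s) ∂coinMeasure =
        ∑ v ∈ hfin.toFinset, ∫ s in φ ⁻¹' {v}, q s v ∂coinMeasure := by
    intro q hq
    have h1 : ∀ v, ∫ s in φ ⁻¹' {v}, q s v ∂coinMeasure =
        ∫ s, (φ ⁻¹' {v}).indicator (fun s => q s v) s ∂coinMeasure := fun v =>
      (integral_indicator (hφ.isOpen_fiber v).measurableSet).symm
    simp_rw [h1]
    rw [← integral_finsetSum (f := fun v s => (φ ⁻¹' {v}).indicator (fun s => q s v) s) _ fun v _ =>
      (hq.apply_continuousLinearMap v).indicator (hφ.isOpen_fiber v).measurableSet]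
    refine integral_congr_ae (Eventually.of_forall fun s => ?_)
    simp only
    rw [Finset.sum_eq_single (φ s)]
    · simp
    · intro v _ hv
      exact Set.indicator_of_notMem (fun hs => hv hs.symm) _
    · intro hs
      simp at hs
  rw [expand k hk]
  simp_rw [fun m => expand (h m) (hh m)]
  exact tendsto_finsetSum _ fun v _ => hlim _ (hφ.isOpen_fiber v).measurableSet v

/-- **Stegall's theorem**, in the form of countable nets: if the dual of `E` has the Radon–Nikodým
property, then there is no bounded uncountable set of functionals that is `ε`-separated by a
countable subset of the unit ball. -/
theorem HasRadonNikodymProperty.countable_of_pairwise_separated {E : Type*} [NormedAddCommGroup E]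
    [NormedSpace ℝ E] (hE : HasRadonNikodymProperty (StrongDual ℝ E)) {x : ℕ → E}
    (hx : ∀ j, ‖x j‖ ≤ 1) {ε : ℝ} (hε : 0 < ε) {M : ℝ} {D : Set (StrongDual ℝ E)}
    (hM : ∀ y ∈ D, ‖y‖ ≤ M) (hsep : D.Pairwise fun y z => ∃ j, ε < |(y - z) (x j)|) :
    D.Countable := by
  classical
  by_contra hD
  let T := {U : Set (StrongDual ℝ E) // U ⊆ D ∧ ¬ U.Countable}
  have hsplit : ∀ U : T, ∃ (V : Bool → T) (j : ℕ) (a : ℝ), (∀ b, (V b).1 ⊆ U.1) ∧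
      (∀ y ∈ (V true).1, a + ε < y (x j)) ∧ ∀ y ∈ (V false).1, y (x j) < a := by
    rintro ⟨U, hUD, hU⟩
    obtain ⟨V, j, a, h1, h2, h3, h4⟩ := exists_uncountable_split hU (hsep.mono hUD)
    exact ⟨fun b => ⟨V b, (h1 b).trans hUD, h2 b⟩, j, a, h1, h3, h4⟩
  choose child dir thr hchild htrue hfalse using hsplit
  have hne : ∀ U : T, ∃ y, y ∈ U.1 := fun U => by
    by_contra! h
    exact U.2.2 ((Set.eq_empty_of_forall_notMem h) ▸ Set.countable_empty)
  choose pt hpt using hne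
  let root : T := ⟨D, subset_rfl, hD⟩
  let h : ℕ → (ℕ → Bool) → StrongDual ℝ E := fun n s => pt (branchNode root child s n)
  -- The direction that splits the current node, signed by the child taken next.
  let φ : ℕ → (ℕ → Bool) → E := fun n s =>
    (if s n then (1 : ℝ) else -1) • x (dir (branchNode root child s n))
  have hint : ∀ m, Integrable (h m) coinMeasure := fun m =>
    ((isLocallyConstant_branchNode root child m).comp pt).integrable_coinMeasure
  have hφ : ∀ n, IsLocallyConstant (φ n) := fun n => by
    have hb : IsLocallyConstant fun s : ℕ → Bool => s n :=
      (IsLocallyConstant.iff_continuous _).2 (continuous_apply n)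
    exact (((isLocallyConstant_branchNode root child n).prodMk hb).comp
      fun p => (if p.2 then (1 : ℝ) else -1) • x (dir p.1))
  have hφ1 : ∀ n s, ‖φ n s‖ ≤ 1 := fun n s => by
    have : ‖(if s n then (1 : ℝ) else -1)‖ = 1 := by split_ifs <;> simp
    simp only [φ, norm_smul, this, one_mul]
    exact hx _
  have hflip : ∀ n s, φ n (flipBit n s) = - φ n s := fun n s => by
    have hc : branchNode root child (flipBit n s) n = branchNode root child s n :=
      branchNode_congr root child n fun i hi => by simp [flipBit, hi.ne]
    simp only [φ, hc]
    cases hs : s n <;> simp [flipBit, hs]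
  -- Flipping bit `n` preserves the measure and changes the sign of `φ n`, so both terms contribute
  -- equally.
  have half : ∀ (q : (ℕ → Bool) → StrongDual ℝ E), Integrable q coinMeasure → ∀ n,
      ∫ s, (q s - q (flipBit n s)) (φ n s) ∂coinMeasure = 2 * ∫ s, q s (φ n s) ∂coinMeasure ∧
      Integrable (fun s => (q s - q (flipBit n s)) (φ n s)) coinMeasure := by
    intro q hq n
    have mp := measurePreserving_flipBit n
    have i1 : Integrable (fun s => q s (φ n s)) coinMeasure := by
      refine hq.norm.mono' ?_ (Eventually.of_forall fun s => ?_)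
      · exact (ContinuousLinearMap.apply ℝ ℝ : E →L[ℝ] _).flip.aestronglyMeasurable_comp₂ hq.1
          (hφ n).integrable_coinMeasure.1
      · exact ((q s).le_opNorm _).trans (mul_le_of_le_one_right (norm_nonneg _) (hφ1 n s))
    have i2 : Integrable (fun s => q (flipBit n s) (φ n (flipBit n s))) coinMeasure :=
      mp.integrable_comp_of_integrable i1
    have e2 : ∫ s, q (flipBit n s) (φ n (flipBit n s)) ∂coinMeasure
        = ∫ s, q s (φ n s) ∂coinMeasure := by
      have := integral_map mp.aemeasurable (f := fun s => q s (φ n s))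
        (by rw [mp.map_eq]; exact i1.1)
      rw [mp.map_eq] at this
      exact this.symm
    have e3 : (fun s => (q s - q (flipBit n s)) (φ n s)) =
        fun s => q s (φ n s) + q (flipBit n s) (φ n (flipBit n s)) := by
      funext s
      rw [hflip]
      simp [sub_eq_add_neg]
    rw [e3]
    exact ⟨by rw [integral_add i1 i2, e2, two_mul], i1.add i2⟩
  have hnode : ∀ n m s, n ≤ m → h m s ∈ (branchNode root child s n).1 := fun n m s hnm =>
    branchNode_antitone root child (fun U : T => U.1) hchild s hnm (hpt _)
  have lower : ∀ n m, n < m → ε / 2 ≤ ∫ s, h m s (φ n s) ∂coinMeasure := by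
    intro n m hnm
    obtain ⟨e, i⟩ := half (h m) (hint m) n
    -- For `m > n` the two values lie in opposite children of one node, and the sign in `φ n`
    -- orients the gap.
    have hpw : ∀ s, ε ≤ (h m s - h m (flipBit n s)) (φ n s) := by
      intro s
      have hc : branchNode root child (flipBit n s) n = branchNode root child s n :=
        branchNode_congr root child n fun i hi => by simp [flipBit, hi.ne]
      have m1 := hnode (n + 1) m s hnm
      have m2 := hnode (n + 1) m (flipBit n s) hnm
      simp only [branchNode, hc] at m1 m2
      cases hs : s n
      · simp only [hs, flipBit, if_true, Bool.not_false] at m1 m2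
        have a1 := hfalse _ _ m1
        have a2 := htrue _ _ m2
        simp only [φ, hs, Bool.false_eq_true, if_false, map_smul, sub_apply, smul_eq_mul]
        change _ ≤ -1 * (h m s _ - h m (flipBit n s) _)
        linarith
      · simp only [hs, flipBit, if_true, Bool.not_true] at m1 m2
        have a1 := htrue _ _ m1
        have a2 := hfalse _ _ m2
        simp only [φ, hs, if_true, one_smul]
        change _ ≤ (h m s _ - h m (flipBit n s) _)
        linarith
    have := integral_mono (integrable_const ε) i hpw
    simp only [integral_const, probReal_univ, one_smul] at this
    linarith
  let U : Ultrafilter ℕ := hyperfilter ℕ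
  have hM' : ∀ m s, ‖h m s‖ ≤ M := fun m s => hM _ ((branchNode root child s m).2.1 (hpt _))
  have hM0 : 0 ≤ M := (norm_nonneg _).trans (hM' 0 fun _ => true)
  obtain ⟨k, hk, hlim⟩ := hE.exists_tendsto_setIntegral coinMeasure U hM0 hM' hint
  have hbig : ∀ n, ε ≤ ∫ s, ‖k s - k (flipBit n s)‖ ∂coinMeasure := by
    intro n
    have h1 := tendsto_integral_apply_of_isLocallyConstant hint hk hlim (hφ n)
    have h2 : ε / 2 ≤ ∫ s, k s (φ n s) ∂coinMeasure := by
      refine ge_of_tendsto h1 ?_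
      have : ∀ᶠ m in (atTop : Filter ℕ), n < m := eventually_gt_atTop n
      have hU : ∀ᶠ m in (U : Filter ℕ), n < m := Nat.hyperfilter_le_atTop this
      exact hU.mono fun m hm => lower n m hm
    obtain ⟨e, i⟩ := half k hk n
    have h3 := integral_mono i (hk.sub
      ((measurePreserving_flipBit n).integrable_comp_of_integrable hk)).norm fun s => by
        refine (le_abs_self _).trans ?_
        exact ((k s - k (flipBit n s)).le_opNorm (φ n s)).trans
          (mul_le_of_le_one_right (norm_nonneg _) (hφ1 n s))
    have h4 : ∫ s, (k s - k (flipBit n s)) (φ n s) ∂coinMeasure ≤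
      ∫ s, ‖k s - k (flipBit n s)‖ ∂coinMeasure := h3
    linarith
  have := ge_of_tendsto' (tendsto_integral_norm_sub_flipBit hk) hbig
  linarith

/-- An uncountable separated set is a countable union of bounded pieces, each countable by Stegall's
theorem. The error relative to `‖v‖` is a closed condition, so it extends from the range of `d` to
its closure. -/
theorem HasRadonNikodymProperty.exists_countable_net {E : Type*} [NormedAddCommGroup E]
    [NormedSpace ℝ E] (hE : HasRadonNikodymProperty (StrongDual ℝ E)) (d : ℕ → E) :
    ∃ C : Set (StrongDual ℝ E), C.Countable ∧ ∀ y : StrongDual ℝ E, ∀ ε : ℝ, 0 < ε → ∃ c ∈ C, ∀ v ∈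
      closure (Set.range d), |y v - c v| ≤ ε * ‖v‖ := by
  let x : ℕ → E := fun j => ‖d j‖⁻¹ • d j
  have hx : ∀ j, ‖x j‖ ≤ 1 := fun j => by
    simp only [x, norm_smul, norm_inv, norm_norm]
    exact inv_mul_le_one
  have step : ∀ ε : ℝ, 0 < ε → ∃ C : Set (StrongDual ℝ E), C.Countable ∧
      ∀ y, ∃ c ∈ C, ∀ j, |(y - c) (x j)| ≤ ε := by
    intro ε hε
    rcases exists_countable_net_or_uncountable_pairwise
      (fun y z : StrongDual ℝ E => ∃ j, ε < |(y - z) (x j)|) (fun y z ⟨j, hj⟩ => ⟨j, by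
        rw [← neg_sub, neg_apply, abs_neg]; exact hj⟩) with ⟨C, hC, h⟩ | ⟨D, hD, hsep⟩
    · refine ⟨C, hC, fun y => ?_⟩
      obtain ⟨c, hc, rfl | hr⟩ := h y
      · exact ⟨y, hc, fun j => by simpa using hε.le⟩
      · exact ⟨c, hc, by simpa using hr⟩
    · refine absurd ?_ hD
      have hcov : D ⊆ ⋃ n : ℕ, {y ∈ D | ‖y‖ ≤ n} := fun y hy => by
        obtain ⟨n, hn⟩ := exists_nat_ge ‖y‖
        exact Set.mem_iUnion.2 ⟨n, hy, hn⟩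
      refine (Set.countable_iUnion fun n : ℕ => ?_).mono hcov
      exact hE.countable_of_pairwise_separated hx hε (M := n) (fun y hy => hy.2)
        (hsep.mono fun y hy => hy.1)
  choose! C hC hCn using step
  refine ⟨⋃ n : ℕ, C (1 / ((n : ℝ) + 1)), Set.countable_iUnion fun n => hC _ (by positivity),
    fun y ε hε => ?_⟩
  obtain ⟨n, hn⟩ := exists_nat_one_div_lt hε
  obtain ⟨c, hc, hcx⟩ := hCn (1 / ((n : ℝ) + 1)) (by positivity) y
  refine ⟨c, Set.mem_iUnion.2 ⟨n, hc⟩, fun v hv => ?_⟩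
  have hclosed : IsClosed {v : E | |y v - c v| ≤ ε * ‖v‖} :=
    isClosed_le (by fun_prop) (by fun_prop)
  refine closure_minimal (s := Set.range d) ?_ hclosed hv
  rintro _ ⟨j, rfl⟩
  have h1 := (hcx j).trans hn.le
  rcases eq_or_ne (d j) 0 with h0 | h0
  · simp [h0]
  · have hpos : 0 < ‖d j‖ := norm_pos_iff.2 h0
    simp only [x, map_smul, smul_eq_mul, abs_mul, abs_inv, abs_norm, sub_apply] at h1
    change |y (d j) - c (d j)| ≤ _
    rw [inv_mul_le_iff₀ hpos] at h1
    linarith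

/-! ### Common subsequences, uniform integrability and truncation -/

/-- Countably many sequences that converge in measure have a common subsequence along which they
converge almost everywhere. -/
theorem exists_common_seq_tendsto_ae {Ω : Type*} [MeasurableSpace Ω] {μ : Measure Ω}
    {X : Type*} [PseudoEMetricSpace X] {u : ℕ → ℕ → Ω → X} {v : ℕ → Ω → X}
    (hu : ∀ i, TendstoInMeasure μ (u i) atTop (v i)) :
    ∃ ns : ℕ → ℕ, StrictMono ns ∧
      ∀ᵐ ω ∂μ, ∀ i, Tendsto (fun n => u i (ns n) ω) atTop (𝓝 (v i ω)) := by
  -- Borel–Cantelli: stage `n` controls the first `n + 1` sequences to precision `2⁻¹ ^ n`, so each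
  -- fixed `i` is controlled from stage `i` on.
  let s : ℕ → ℕ → Set Ω := fun n k =>
    ⋃ i ∈ Finset.range (n + 1), {ω | (2⁻¹ : ℝ≥0∞) ^ n ≤ edist (u i k ω) (v i ω)}
  have hpos : ∀ n : ℕ, (0 : ℝ≥0∞) < 2⁻¹ ^ n := fun n => ENNReal.pow_pos (by simp) n
  have hs : ∀ n, ∀ᶠ k in atTop, μ (s n k) ≤ 2⁻¹ ^ n := by
    intro n
    have hle : ∀ k, μ (s n k) ≤ ∑ i ∈ Finset.range (n + 1),
        μ {ω | (2⁻¹ : ℝ≥0∞) ^ n ≤ edist (u i k ω) (v i ω)} := fun k =>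
      measure_biUnion_finset_le _ _
    have ht : Tendsto (fun k => ∑ i ∈ Finset.range (n + 1),
        μ {ω | (2⁻¹ : ℝ≥0∞) ^ n ≤ edist (u i k ω) (v i ω)}) atTop (𝓝 0) := by
      have := tendsto_finsetSum (Finset.range (n + 1)) fun i _ => hu i _ (hpos n)
      simpa using this
    filter_upwards [ht.eventually_lt_const (hpos n)] with k hk
    exact (hle k).trans hk.le
  obtain ⟨ns, hns, hns'⟩ := extraction_forall_of_eventually hs
  refine ⟨ns, hns, ?_⟩
  have hsum : ∑' n, μ (s n (ns n)) ≠ ∞ := by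
    refine ne_top_of_le_ne_top ?_ (ENNReal.tsum_le_tsum hns')
    rw [ENNReal.tsum_geometric]
    simp
  filter_upwards [ae_eventually_notMem hsum] with ω hω i
  rw [tendsto_iff_edist_tendsto_0]
  refine tendsto_of_tendsto_of_tendsto_of_le_of_le' tendsto_const_nhds
    (ENNReal.tendsto_pow_atTop_nhds_zero_of_lt_one (r := 2⁻¹) (by simp))
    (Eventually.of_forall fun _ => zero_le) ?_
  filter_upwards [hω, eventually_ge_atTop i] with n hn hin
  by_contra! hlt
  exact hn (Set.mem_biUnion (by simpa [Nat.lt_succ_iff] using hin) hlt.le)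

theorem IsUniformlyIntegrableSeq.uniformIntegrable {Ω : Type*} [MeasurableSpace Ω]
    {μ : Measure Ω} [IsFiniteMeasure μ] {E : Type*} [NormedAddCommGroup E] {f : ℕ → Ω → E}
    (hui : IsUniformlyIntegrableSeq μ f) (hf : ∀ k, AEStronglyMeasurable (f k) μ) :
    UniformIntegrable f 1 μ := by
  refine uniformIntegrable_of le_rfl ENNReal.one_ne_top hf fun ε hε => ?_
  have h1 := hui.eventually_lt_const (ENNReal.ofReal_pos.2 hε)
  obtain ⟨c, hc, hc0⟩ := (h1.and (eventually_ge_atTop 0)).exists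
  refine ⟨⟨c, hc0⟩, fun i => ?_⟩
  rw [eLpNorm_one_eq_lintegral_enorm]
  simp_rw [enorm_indicator_eq_indicator_enorm]
  refine (lintegral_indicator_le _ _).trans ?_
  exact (le_iSup (fun k => ∫⁻ ω in {ω | c ≤ ‖f k ω‖}, ‖f k ω‖ₑ ∂μ) i).trans hc.le

theorem MeasureTheory.UnifIntegrable.const_mul_norm {Ω ι : Type*} [MeasurableSpace Ω] {μ : Measure Ω}
    {E : Type*} [NormedAddCommGroup E] {h : ι → Ω → E} (hh : UnifIntegrable h 1 μ)
    {C : ℝ} (hC : 0 < C) : UnifIntegrable (fun k ω => C * ‖h k ω‖) 1 μ := by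
  intro ε hε
  obtain ⟨δ, hδ, H⟩ := hh (div_pos hε hC)
  refine ⟨δ, hδ, fun i s hs hμ => ?_⟩
  have : eLpNorm (s.indicator fun ω => C * ‖h i ω‖) 1 μ ≤
      ENNReal.ofReal C * eLpNorm (s.indicator (h i)) 1 μ := by
    refine eLpNorm_le_mul_eLpNorm_of_ae_le_mul (Eventually.of_forall fun ω => ?_) 1
    by_cases hω : ω ∈ s
    · simp [hω, abs_of_pos hC]
    · simp [hω]
  refine this.trans ((mul_le_mul_right (H i s hs hμ) _).trans_eq ?_)
  rw [← ENNReal.ofReal_mul hC.le, mul_div_cancel₀ _ hC.ne']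

/-- For test functions, pointwise weak convergence on a countable net of functionals suffices. -/
theorem IsLimitedTestFunction.tendsto_integral {Ω : Type*} [MeasurableSpace Ω]
    {μ : Measure Ω} [IsFiniteMeasure μ] {E : Type*} [NormedAddCommGroup E] [NormedSpace ℝ E]
    {g : Ω → E → ℝ} (hg : IsLimitedTestFunction μ g) {C₀ : ℝ} (hC₀ : 0 < C₀) {φ : Ω → ℝ}
    (hbound : ∀ ω x, |g ω x| ≤ C₀ * ‖x‖ + φ ω) {H : ℕ → Ω → E}
    (hH : ∀ n, Integrable (H n) μ)
    (hui : UniformIntegrable (fun n ω => C₀ * ‖H n ω‖ + φ ω) 1 μ)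
    {K : Set E} (hK : ∀ᵐ ω ∂μ, ∀ n, H n ω ∈ K)
    {C : Set (StrongDual ℝ E)}
    (hC : ∀ y : StrongDual ℝ E, ∀ ε : ℝ, 0 < ε → ∃ c ∈ C, ∀ v ∈ K, |y v - c v| ≤ ε * ‖v‖)
    (hlim : ∀ᵐ ω ∂μ, ∀ c ∈ C, Tendsto (fun n => c (H n ω)) atTop (𝓝 0)) :
    Tendsto (fun n => ∫ ω, g ω (H n ω) ∂μ) atTop (𝓝 0) := by
  classical
  have hφ0 : ∀ ω, 0 ≤ φ ω := fun ω => by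
    have := hbound ω 0
    rw [hg.map_zero] at this
    simpa using this
  rw [Metric.tendsto_atTop]
  intro ε hε
  obtain ⟨c, hc⟩ := hui.spec one_ne_zero ENNReal.one_ne_top (half_pos hε)
  let ψ : ℕ → Ω → ℝ := fun n ω => C₀ * ‖H n ω‖ + φ ω
  have hψ0 : ∀ n ω, 0 ≤ ψ n ω := fun n ω =>
    add_nonneg (mul_nonneg hC₀.le (norm_nonneg _)) (hφ0 ω)
  have hψi : ∀ n, Integrable (ψ n) μ := fun n => memLp_one_iff_integrable.1 (hui.memLp n)
  let B : ℕ → Set Ω := fun n => {ω | c ≤ ‖ψ n ω‖₊}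
  have hB : ∀ n, NullMeasurableSet (B n) μ := fun n =>
    nullMeasurableSet_le aemeasurable_const (hψi n).1.nnnorm.aemeasurable
  have hBmem : ∀ n ω, ω ∈ B n ↔ c ≤ ψ n ω := fun n ω => by
    change c ≤ ‖ψ n ω‖₊ ↔ _
    rw [← NNReal.coe_le_coe, coe_nnnorm, Real.norm_of_nonneg (hψ0 n ω)]
  -- The value 0 on `B n` costs nothing, as `g` vanishes there; off `B n` the majorant is below `c`,
  -- which bounds both `H n` and `g`.
  let T : ℕ → Ω → E := fun n => (B n)ᶜ.indicator (H n)
  have hT : ∀ n, Integrable (T n) μ := fun n => (hH n).indicator₀ (hB n).compl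
  have hTbound : ∀ n ω, |g ω (T n ω)| ≤ c := by
    intro n ω
    by_cases hω : ω ∈ B n
    · simp [T, hω, hg.map_zero]
    · simp only [T, Set.indicator_of_mem (show ω ∈ (B n)ᶜ from hω)]
      rw [hBmem, not_le] at hω
      exact (hbound _ _).trans hω.le
  have hTnorm : ∀ n ω, ‖T n ω‖ ≤ c / C₀ := by
    intro n ω
    by_cases hω : ω ∈ B n
    · simp only [T, Set.indicator_of_notMem (show ω ∉ (B n)ᶜ from not_not.2 hω), norm_zero]
      positivity
    · simp only [T, Set.indicator_of_mem (show ω ∈ (B n)ᶜ from hω)]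
      rw [hBmem, not_le] at hω
      rw [le_div_iff₀' hC₀]
      linarith [hφ0 ω]
  have hweak : ∀ᵐ ω ∂μ, ∀ y : StrongDual ℝ E, Tendsto (fun n => y (T n ω)) atTop (𝓝 0) := by
    filter_upwards [hK, hlim] with ω hKω hlimω y
    rw [Metric.tendsto_atTop]
    intro η hη
    -- With norms at most `c / C₀` this accuracy gives an error of at most `η / 2`; the `+ 1` covers
    -- `c = 0`.
    obtain ⟨z, hz, hyz⟩ := hC y (η / (2 * (c / C₀ + 1))) (by positivity)
    obtain ⟨N, hN⟩ := Metric.tendsto_atTop.1 (hlimω z hz) (η / 2) (half_pos hη)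
    refine ⟨N, fun n hn => ?_⟩
    have h1 := hN n hn
    rw [Real.dist_0_eq_abs] at h1 ⊢
    have hTn := hTnorm n ω
    by_cases hω : ω ∈ B n
    · simpa [T, hω] using hη
    · simp only [T, Set.indicator_of_mem (show ω ∈ (B n)ᶜ from hω)] at hTn ⊢
      have h2 := hyz _ (hKω n)
      have h3 : η / (2 * (c / C₀ + 1)) * ‖H n ω‖ ≤ η / 2 := by
        rw [div_mul_eq_mul_div, div_le_div_iff₀ (by positivity) two_pos]
        nlinarith
      have h4 : |y (H n ω)| ≤ |y (H n ω) - z (H n ω)| + |z (H n ω)| := by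
        simpa using abs_add_le (y (H n ω) - z (H n ω)) (z (H n ω))
      linarith
  have hTlim : Tendsto (fun n => ∫ ω, g ω (T n ω) ∂μ) atTop (𝓝 0) := by
    have h0 : (0 : ℝ) = ∫ _, (0 : ℝ) ∂μ := by simp
    rw [h0]
    refine tendsto_integral_of_dominated_convergence (fun _ => (c : ℝ))
      (fun n => (hg.integrable_comp (hT n)).1) (integrable_const _)
      (fun n => Eventually.of_forall (hTbound n)) ?_
    filter_upwards [hweak] with ω hω
    have hw : Tendsto (fun n => toWeakSpace ℝ E (T n ω)) atTop (𝓝 (toWeakSpace ℝ E 0)) := by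
      have hind : IsInducing fun (x : WeakSpace ℝ E) (y : StrongDual ℝ E) =>
          y ((toWeakSpace ℝ E).symm x) := ⟨rfl⟩
      refine hind.tendsto_nhds_iff.2 ?_
      rw [tendsto_pi_nhds]
      intro y
      have : Tendsto (fun n => y (T n ω)) atTop (𝓝 (y 0)) := by simpa using hω y
      exact this
    have := ((hg.weakly_continuous ω).tendsto (toWeakSpace ℝ E 0)).comp hw
    simpa [Function.comp_def, hg.map_zero] using this
  obtain ⟨N, hN⟩ := Metric.tendsto_atTop.1 hTlim (ε / 2) (half_pos hε)
  refine ⟨N, fun n hn => ?_⟩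
  have h1 := hN n hn
  rw [Real.dist_0_eq_abs] at h1 ⊢
  -- The integrands differ only on `B n`, by at most `ψ n`, whose integral there is at most `ε / 2`
  -- by the choice of `c`.
  have h2 : ‖∫ ω, g ω (H n ω) ∂μ - ∫ ω, g ω (T n ω) ∂μ‖ ≤ ε / 2 := by
    rw [← integral_sub (hg.integrable_comp (hH n)) (hg.integrable_comp (hT n))]
    have hi : Integrable ((B n).indicator (ψ n)) μ := (hψi n).indicator₀ (hB n)
    refine (norm_integral_le_of_norm_le hi (Eventually.of_forall fun ω => ?_)).trans ?_
    · by_cases hω : ω ∈ B n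
      · simpa [T, hω, hg.map_zero] using hbound ω (H n ω)
      · simp [T, hω]
    · have h3 := hc n
      rw [eLpNorm_one_eq_lintegral_enorm] at h3
      refine (le_abs_self _).trans ((norm_integral_le_lintegral_norm (_ : Ω → ℝ)).trans ?_)
      refine ENNReal.toReal_le_of_le_ofReal (half_pos hε).le ?_
      simpa only [ofReal_norm] using h3
  have h4 := abs_add_le (∫ ω, g ω (H n ω) ∂μ - ∫ ω, g ω (T n ω) ∂μ) (∫ ω, g ω (T n ω) ∂μ)
  rw [sub_add_cancel] at h4
  rw [Real.norm_eq_abs] at h2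
  linarith

/-! ### Reduction to a separable set and conclusion -/

theorem exists_seq_ae_mem_closure_range {Ω : Type*} [MeasurableSpace Ω] {μ : Measure Ω}
    {X : Type*} [PseudoMetricSpace X] [Nonempty X] {h : ℕ → Ω → X}
    (hh : ∀ k, AEStronglyMeasurable (h k) μ) :
    ∃ d : ℕ → X, ∀ᵐ ω ∂μ, ∀ k, h k ω ∈ closure (Set.range d) := by
  choose t ht hmem using fun k => (hh k).isSeparable_ae_range
  obtain ⟨D, hD, hDt⟩ := TopologicalSpace.IsSeparable.iUnion ht
  -- An extra point makes the countable set nonempty, so that a sequence can enumerate it.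
  obtain ⟨d, hd⟩ := (hD.insert (Classical.arbitrary X)).exists_eq_range (Set.insert_nonempty _ _)
  refine ⟨d, ?_⟩
  filter_upwards [ae_all_iff.2 hmem] with ω hω k
  rw [← hd]
  exact closure_mono (Set.subset_insert _ _) (hDt (Set.mem_iUnion.2 ⟨k, hω k⟩))

theorem theorem3p5 {E : Type*} [NormedAddCommGroup E] [NormedSpace ℝ E] [CompleteSpace E]
    (hE : HasRadonNikodymProperty (StrongDual ℝ E))
    {Ω : Type*} [MeasurableSpace Ω] (μ : Measure Ω) [IsFiniteMeasure μ]
    (f : ℕ → Ω → E) (f₀ : Ω → E)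
    (hf : ∀ k, Integrable (f k) μ) (hf₀ : Integrable f₀ μ)
    (hui : IsUniformlyIntegrableSeq μ f)
    (hconv : TendstoScalarlyInMeasure μ f f₀) :
    TendstoLimitedly μ f f₀ := by
  intro g hg
  obtain ⟨C₀, hC₀, φ, hφ, hbound⟩ := hg.growth
  have hh : ∀ k, Integrable (fun ω => f k ω - f₀ ω) μ := fun k => (hf k).sub hf₀
  obtain ⟨d, hd⟩ := exists_seq_ae_mem_closure_range fun k => (hh k).1
  obtain ⟨C, hC, hnet⟩ := hE.exists_countable_net d
  have hCne : C.Nonempty := (hnet 0 1 one_pos).imp fun _ h => h.1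
  obtain ⟨y, rfl⟩ := hC.exists_eq_range hCne
  have hfui := hui.uniformIntegrable fun k => (hf k).1
  have hdiff : UnifIntegrable (fun k ω => f k ω - f₀ ω) 1 μ :=
    hfui.unifIntegrable.sub (unifIntegrable_const le_rfl ENNReal.one_ne_top
      (memLp_one_iff_integrable.2 hf₀)) le_rfl (fun k => (hf k).1) fun _ => hf₀.1
  have hψ : UnifIntegrable (fun k ω => C₀ * ‖f k ω - f₀ ω‖ + φ ω) 1 μ :=
    (hdiff.const_mul_norm hC₀).add (unifIntegrable_const le_rfl ENNReal.one_ne_top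
      (memLp_one_iff_integrable.2 hφ)) le_rfl (fun k => ((hh k).norm.const_mul C₀).1)
      fun _ => hφ.1
  have hψb : ∃ M : NNReal, ∀ k, eLpNorm (fun ω => C₀ * ‖f k ω - f₀ ω‖ + φ ω) 1 μ ≤ M := by
    obtain ⟨M, hM⟩ := hfui.2.2
    have h0 := (memLp_one_iff_integrable.2 hf₀).2
    have h1 := (memLp_one_iff_integrable.2 hφ).2
    refine ⟨(ENNReal.ofReal C₀ * (M + eLpNorm f₀ 1 μ) + eLpNorm φ 1 μ).toNNReal, fun k => ?_⟩
    rw [ENNReal.coe_toNNReal (by finiteness)]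
    refine (eLpNorm_add_le ((hh k).norm.const_mul C₀).1 hφ.1 le_rfl).trans ?_
    gcongr
    refine (eLpNorm_le_mul_eLpNorm_of_ae_le_mul (g := fun ω => f k ω - f₀ ω) (c := C₀)
      (Eventually.of_forall fun ω => ?_) 1).trans ?_
    · simp [abs_of_pos hC₀]
    · gcongr
      exact (eLpNorm_sub_le (hf k).1 hf₀.1 le_rfl).trans (by gcongr; exact hM k)
  -- Convergence in measure gives almost everywhere convergence only along subsequences, which
  -- suffices for a limit of real numbers.
  refine tendsto_of_subseq_tendsto fun ns hns => ?_
  have hu : ∀ i, TendstoInMeasure μ (fun n ω => y i (f (ns n) ω)) atTop fun ω => y i (f₀ ω) :=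
    fun i => (hconv (y i)).comp hns
  obtain ⟨ms, -, hms⟩ := exists_common_seq_tendsto_ae hu
  refine ⟨ms, hg.tendsto_integral hC₀ hbound (fun n => hh (ns (ms n)))
    ⟨fun n => (((hh _).norm.const_mul C₀).add hφ).1, fun ε hε => ?_, ?_⟩
    (hd.mono fun ω hω n => hω _) hnet ?_⟩
  · obtain ⟨δ, hδ, h⟩ := hψ hε
    exact ⟨δ, hδ, fun n => h (ns (ms n))⟩
  · exact hψb.imp fun M h n => h (ns (ms n))
  · filter_upwards [hms] with ω hω
    rintro _ ⟨i, rfl⟩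
    have := (hω i).sub_const (y i (f₀ ω))
    simpa using this
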